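/- Let $\phi(x)=\frac{1}{\sqrt{2\pi}}e^{-x^2/2}$ be the standard Gaussian density and, for a probability distribution $P$ on $\mathbb{R}$, let $f_P(x)=\int \phi(x-\theta)\,dP(\theta)$ be the density of the Gaussian mixture $P*\phi$. For densities $f,g$ on $\mathbb{R}$ let $\mathrm{TV}(f,g)=\frac12\int_{\mathbb{R}}|f-g|\,dx$. For an integer $m\ge 1$, let $\mathcal{P}_m$ be the set of probability distributions on $\mathbb{R}$ supported on at most $m$ points, and put $$\mathcal{E}^\star(m,P,\mathrm{TV})=\inf_{P_m\in\mathcal{P}_m}\mathrm{TV}(f_{P_m},f_P),\qquad \mathcal{E}^\star(m,\mathcal{P},\mathrm{TV})=\sup_{P\in\mathcal{P}}\mathcal{E}^\star(m,P,\mathrm{TV})$$ for a family $\mathcal{P}$ of probability distributions on $\mathbb{R}$. For $M>0$ let $\mathcal{P}^{\mathrm{bdd}}(M)$ be the family of all probability distributions $P$ on $\mathbb{R}$ with $P([-M,M])=1$, and let $\mathrm{Unif}[-M,M]$ be the uniform distribution on $[-M,M]$. For every real $M>0$ and every integer $m\ge1$, $$\mathcal{E}^\star(m,\mathrm{Unif}[-M,M],\mathrm{TV})\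 \ge\ \frac{1}{4m}\exp\left(-\frac{\pi^2m^2}{2M^2}\right).$$ Furthermore, there exist universal constants $C_1,C'>0$ such that for every real $M>0$ and every integer $m\ge 1$ with $m\ge C'M^2$, $$\mathcal{E}^\star(m,\mathcal{P}^{\mathrm{bdd}}(M),\mathrm{TV})\ \ge\ \exp\left(-C_1\,m\log\frac{m}{M^2}\right).$$ -/

import Mathlib

open MeasureTheory ProbabilityTheory
open scoped ENNReal

noncomputable section

/-- The density `f_P(x) = ∫ φ(x - θ) dP(θ)` of the Gaussian location mixture `P * φ`, where `φ` is
the density of `N(0, 1)` and `P` is the mixing distribution. -/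
def mixtureDensity (P : Measure ℝ) (x : ℝ) : ℝ :=
  ∫ θ, gaussianPDFReal 0 1 (x - θ) ∂P

/-- The total variation distance `(1/2) ∫ |f - g|` between two densities on the real line. -/
def tvDist (f g : ℝ → ℝ) : ℝ≥0∞ :=
  (∫⁻ x, ENNReal.ofReal |f x - g x|) / 2

/-- The probability distributions on the real line with at most `m` atoms: those that give full
mass to a set of at most `m` points. -/
def atomicDistributions (m : ℕ) : Set (Measure ℝ) :=
  {Q | IsProbabilityMeasure Q ∧ ∃ s : Finset ℝ, s.card ≤ m ∧ Q ((s : Set ℝ)ᶜ) = 0}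

/-- The best approximation error `E*(m, P, d)` of the mixture density `f_P` by mixtures with at
most `m` components, in the loss `d`. -/
def bestError (m : ℕ) (P : Measure ℝ) (d : (ℝ → ℝ) → (ℝ → ℝ) → ℝ≥0∞) : ℝ≥0∞ :=
  ⨅ Q ∈ atomicDistributions m, d (mixtureDensity Q) (mixtureDensity P)

/-- The worst-case approximation error `E*(m, F, d)` over a family `F` of mixing distributions. -/
def worstError (m : ℕ) (F : Set (Measure ℝ)) (d : (ℝ → ℝ) → (ℝ → ℝ) → ℝ≥0∞) : ℝ≥0∞ :=
  ⨆ P ∈ F, bestError m P d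

/-- The family of all probability distributions `P` with `P[-M, M] = 1`. -/
def boundedDistributions (M : ℝ) : Set (Measure ℝ) :=
  {P | IsProbabilityMeasure P ∧ P (Set.Icc (-M) M) = 1}

/-- The uniform distribution on `[-M, M]` (Lebesgue measure conditioned on the interval). -/
def uniformDistribution (M : ℝ) : Measure ℝ :=
  ProbabilityTheory.cond volume (Set.Icc (-M) M)

end

/-!
If `Q` has at most `m` atoms and `ω > 0`, some monic polynomial `p` of degree `m` vanishes at
`exp (i ω θ)` for every atom `θ` of `Q`, so the trigonometric polynomial `|p (exp (i ω θ))| ^ 2` has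
`Q`-expectation zero. Its expectation under any distribution is the Toeplitz form
`∑ p_j conj p_k χ((j - k) ω)` in the characteristic function `χ` (`integral_normSq_eval_exp`). The
characteristic functions of `P` and `Q` at `a` differ by at most `2 exp (a ^ 2 / 2)` times the total
variation distance of the mixtures (`norm_charFun_sub_le`), because convolution with the Gaussian
multiplies them by `exp (-a ^ 2 / 2)`. Hence a lower bound for the `P`-expectation of
`|p (exp (i ω θ))| ^ 2` yields one for the distance (`abs_integral_normSq_eval_sub_le`).

For the uniform distribution on `[-M, M]` take `ω = π / M`: the Toeplitz matrix is the identity, the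
`P`-expectation is `∑ |p_j| ^ 2`, and the Cauchy-Schwarz inequality gives the first bound.

For the worst case take `P` uniform on `m + 1` equally spaced points of `[-M, M]` and
`ω = 1 / √m`, so that `exp ((m ω) ^ 2 / 2)` is only exponential in `m`. Since `p` is monic of degree
`m`, Lagrange interpolation shows that its values at the `m + 1` points cannot all be small
(`Polynomial.Monic.le_sum_norm_eval`); the products of chord lengths that enter are at least
`(M / (5 √m)) ^ m` (`pow_le_prod_norm_exp_sub`), while the coefficients of `p` have total size at
most `2 ^ m`.
-/

open MeasureTheory ProbabilityTheory
open scoped ENNReal Convolution ComplexConjugate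

/-! ### The characteristic function and the total variation distance -/

theorem mixtureDensity_mul_exp (P : Measure ℝ) (a x : ℝ) :
    (mixtureDensity P x : ℂ) * Complex.exp (a * x * Complex.I) =
      ((fun θ : ℝ => Complex.exp (a * θ * Complex.I)) ⋆[ContinuousLinearMap.mul ℝ ℂ, P]
        fun y : ℝ => (gaussianPDFReal 0 1 y : ℂ) * Complex.exp (a * y * Complex.I)) x := by
  rw [convolution, mixtureDensity, ← integral_complex_ofReal, ← integral_mul_const]
  congr 1 with θ
  rw [ContinuousLinearMap.mul_apply', mul_left_comm, ← Complex.exp_add]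
  congr 2
  push_cast
  ring

theorem integrable_exp_mul_I (P : Measure ℝ) [IsProbabilityMeasure P] (a : ℝ) :
    Integrable (fun θ : ℝ => Complex.exp (a * θ * Complex.I)) P := by
  refine Integrable.of_bound (by fun_prop) 1 (ae_of_all _ fun θ => ?_)
  rw [← Complex.ofReal_mul, Complex.norm_exp_ofReal_mul_I]

theorem integrable_gaussianPDFReal_mul_exp (a : ℝ) :
    Integrable (fun y : ℝ => (gaussianPDFReal 0 1 y : ℂ) * Complex.exp (a * y * Complex.I)) := by
  refine ((integrable_gaussianPDFReal 0 1).ofReal (𝕜 := ℂ)).mul_bdd (c := 1)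
    (by fun_prop) (ae_of_all _ fun y => ?_)
  rw [← Complex.ofReal_mul, Complex.norm_exp_ofReal_mul_I]

theorem integrable_mixtureDensity_mul_exp (P : Measure ℝ) [IsProbabilityMeasure P] (a : ℝ) :
    Integrable fun x : ℝ => (mixtureDensity P x : ℂ) * Complex.exp (a * x * Complex.I) := by
  simp_rw [mixtureDensity_mul_exp]
  exact ((integrable_exp_mul_I P a).convolution_integrand (ContinuousLinearMap.mul ℝ ℂ)
    (integrable_gaussianPDFReal_mul_exp a)).integral_prod_left

theorem integrable_mixtureDensity (P : Measure ℝ) [IsProbabilityMeasure P] :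
    Integrable (mixtureDensity P) := by
  simpa using (integrable_mixtureDensity_mul_exp P 0).re

/-- Convolution with the standard Gaussian multiplies the characteristic function by
`exp (-a² / 2)`. -/
theorem integral_mixtureDensity_mul_exp (P : Measure ℝ) [IsProbabilityMeasure P] (a : ℝ) :
    ∫ x : ℝ, (mixtureDensity P x : ℂ) * Complex.exp (a * x * Complex.I) =
      charFun P a * (Real.exp (-(a ^ 2 / 2)) : ℂ) := by
  simp_rw [mixtureDensity_mul_exp]
  rw [integral_convolution (ContinuousLinearMap.mul ℝ ℂ) (integrable_exp_mul_I P a)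
    (integrable_gaussianPDFReal_mul_exp a), ContinuousLinearMap.mul_apply', charFun_apply_real]
  congr 1
  have h := charFun_gaussianReal (μ := 0) (v := 1) a
  rw [charFun_apply_real, integral_gaussianReal_eq_integral_smul one_ne_zero] at h
  simp only [Complex.real_smul] at h
  rw [h]
  push_cast
  congr 1
  ring

theorem ofReal_integral_abs_sub_le_tvDist (P Q : Measure ℝ) [IsProbabilityMeasure P]
    [IsProbabilityMeasure Q] :
    ENNReal.ofReal ((∫ x, |mixtureDensity Q x - mixtureDensity P x|) / 2) ≤
      tvDist (mixtureDensity Q) (mixtureDensity P) := by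
  have h : Integrable fun x => |mixtureDensity Q x - mixtureDensity P x| :=
    ((integrable_mixtureDensity Q).sub (integrable_mixtureDensity P)).abs
  rw [tvDist, ENNReal.ofReal_div_of_pos two_pos,
    ofReal_integral_eq_lintegral_ofReal h (ae_of_all _ fun x => abs_nonneg _)]
  simp

/-- The integral on the right is twice the total variation distance of the mixtures. -/
theorem norm_charFun_sub_le (P Q : Measure ℝ) [IsProbabilityMeasure P] [IsProbabilityMeasure Q]
    (a : ℝ) :
    ‖charFun Q a - charFun P a‖ ≤
      Real.exp (a ^ 2 / 2) * ∫ x, |mixtureDensity Q x - mixtureDensity P x| := by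
  have h : (charFun Q a - charFun P a) * (Real.exp (-(a ^ 2 / 2)) : ℂ) =
      ∫ x : ℝ, ((mixtureDensity Q x - mixtureDensity P x : ℝ) : ℂ) *
        Complex.exp (a * x * Complex.I) := by
    rw [sub_mul, ← integral_mixtureDensity_mul_exp, ← integral_mixtureDensity_mul_exp,
      ← integral_sub (integrable_mixtureDensity_mul_exp Q a)
        (integrable_mixtureDensity_mul_exp P a)]
    simp_rw [Complex.ofReal_sub, sub_mul]
  have h2 : ‖charFun Q a - charFun P a‖ * Real.exp (-(a ^ 2 / 2)) ≤
      ∫ x, |mixtureDensity Q x - mixtureDensity P x| := by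
    calc _ = ‖(charFun Q a - charFun P a) * (Real.exp (-(a ^ 2 / 2)) : ℂ)‖ := by
          rw [norm_mul, Complex.norm_real, Real.norm_of_nonneg (Real.exp_pos _).le]
      _ ≤ _ := by
          rw [h]
          refine (norm_integral_le_integral_norm _).trans_eq ?_
          congr 1 with x
          rw [norm_mul, ← Complex.ofReal_mul a x, Complex.norm_exp_ofReal_mul_I, mul_one,
            Complex.norm_real, Real.norm_eq_abs]
  rw [Real.exp_neg, ← div_eq_mul_inv, div_le_iff₀ (Real.exp_pos _)] at h2
  linarith

/-! ### Squared moduli of trigonometric polynomials -/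

open Polynomial in
/-- The squared modulus of a trigonometric polynomial is the Toeplitz form of its coefficients. -/
theorem normSq_eval_exp (p : ℂ[X]) (m : ℕ) (hp : p.natDegree ≤ m) (ω θ : ℝ) :
    ((‖p.eval (Complex.exp (ω * θ * Complex.I))‖ ^ 2 : ℝ) : ℂ) =
      ∑ j ∈ Finset.range (m + 1), ∑ k ∈ Finset.range (m + 1), p.coeff j * conj (p.coeff k) *
        Complex.exp ((((j : ℝ) - k) * ω : ℝ) * θ * Complex.I) := by
  rw [Complex.ofReal_pow, ← Complex.mul_conj', eval_eq_sum_range' (Nat.lt_succ_of_le hp), map_sum,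
    Finset.sum_mul_sum]
  refine Finset.sum_congr rfl fun j _ => Finset.sum_congr rfl fun k _ => ?_
  rw [map_mul, map_pow, ← Complex.exp_conj, ← Complex.exp_nat_mul, ← Complex.exp_nat_mul,
    mul_mul_mul_comm, ← Complex.exp_add]
  congr 2
  simp
  ring

open Polynomial in
theorem integral_normSq_eval_exp (P : Measure ℝ) [IsProbabilityMeasure P] (p : ℂ[X]) (m : ℕ)
    (hp : p.natDegree ≤ m) (ω : ℝ) :
    ((∫ θ : ℝ, ‖p.eval (Complex.exp (ω * θ * Complex.I))‖ ^ 2 ∂P : ℝ) : ℂ) =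
      ∑ j ∈ Finset.range (m + 1), ∑ k ∈ Finset.range (m + 1), p.coeff j * conj (p.coeff k) *
        charFun P (((j : ℝ) - k) * ω) := by
  have hi (j k : ℕ) : Integrable (fun θ : ℝ => p.coeff j * conj (p.coeff k) *
        Complex.exp ((((j : ℝ) - k) * ω : ℝ) * θ * Complex.I)) P :=
    (integrable_exp_mul_I P _).const_mul _
  rw [← integral_complex_ofReal]
  simp_rw [normSq_eval_exp p m hp]
  rw [integral_finsetSum _ fun j _ => integrable_finsetSum _ fun k _ => hi j k]
  refine Finset.sum_congr rfl fun j _ => ?_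
  rw [integral_finsetSum _ fun k _ => hi j k]
  refine Finset.sum_congr rfl fun k _ => ?_
  rw [integral_const_mul, charFun_apply_real]

open Polynomial in
/-- A pair of mixtures close in total variation gives nearly equal expectations to the squared
modulus of a trigonometric polynomial. The diagonal terms drop out because both characteristic
functions are `1` at `0`. -/
theorem abs_integral_normSq_eval_sub_le (P Q : Measure ℝ) [IsProbabilityMeasure P]
    [IsProbabilityMeasure Q] (p : ℂ[X]) (m : ℕ) (hp : p.natDegree ≤ m) (ω : ℝ) :
    |(∫ θ : ℝ, ‖p.eval (Complex.exp (ω * θ * Complex.I))‖ ^ 2 ∂Q) -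
        ∫ θ : ℝ, ‖p.eval (Complex.exp (ω * θ * Complex.I))‖ ^ 2 ∂P| ≤
      ((∑ j ∈ Finset.range (m + 1), ‖p.coeff j‖) ^ 2 -
        ∑ j ∈ Finset.range (m + 1), ‖p.coeff j‖ ^ 2) *
      (Real.exp ((m * ω) ^ 2 / 2) * ∫ x, |mixtureDensity Q x - mixtureDensity P x|) := by
  set T := ∫ x, |mixtureDensity Q x - mixtureDensity P x|
  have hT0 : 0 ≤ T := integral_nonneg fun x => abs_nonneg _
  set E := Real.exp ((m * ω) ^ 2 / 2) * T
  have hterm : ∀ j ∈ Finset.range (m + 1), ∀ k ∈ Finset.range (m + 1),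
      ‖p.coeff j * conj (p.coeff k) *
        (charFun Q (((j : ℝ) - k) * ω) - charFun P (((j : ℝ) - k) * ω))‖ ≤
      (‖p.coeff j‖ * ‖p.coeff k‖ - if j = k then ‖p.coeff j‖ ^ 2 else 0) * E := by
    intro j hj k hk
    split_ifs with hjk
    · subst hjk
      simp [sq]
    · rw [norm_mul, norm_mul, RCLike.norm_conj, sub_zero]
      refine mul_le_mul_of_nonneg_left ((norm_charFun_sub_le P Q _).trans ?_) (by positivity)
      refine mul_le_mul_of_nonneg_right (Real.exp_le_exp.2 ?_) hT0
      rw [mul_pow, mul_pow]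
      have hj' : (j : ℝ) ≤ m := by exact_mod_cast Nat.lt_succ_iff.1 (Finset.mem_range.1 hj)
      have hk' : (k : ℝ) ≤ m := by exact_mod_cast Nat.lt_succ_iff.1 (Finset.mem_range.1 hk)
      have : ((j : ℝ) - k) ^ 2 ≤ (m : ℝ) ^ 2 :=
        sq_le_sq' (by linarith [j.cast_nonneg (α := ℝ)]) (by linarith [k.cast_nonneg (α := ℝ)])
      gcongr
  rw [← Real.norm_eq_abs, ← Complex.norm_real, Complex.ofReal_sub,
    integral_normSq_eval_exp Q p m hp, integral_normSq_eval_exp P p m hp,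
    ← Finset.sum_sub_distrib]
  simp_rw [← Finset.sum_sub_distrib, ← mul_sub]
  refine (norm_sum_le_of_le _ fun j hj => norm_sum_le_of_le _ fun k hk =>
    hterm j hj k hk).trans_eq ?_
  simp_rw [← Finset.sum_mul, Finset.sum_sub_distrib, ← Finset.mul_sum, ← Finset.sum_mul]
  congr 2
  · rw [sq]
  · refine Finset.sum_congr rfl fun j hj => ?_
    rw [Finset.sum_ite_eq, if_pos hj]

open Polynomial in
/-- A monic polynomial of degree exactly `m`, with coefficients of total size at most `2 ^ m`, that
vanishes at the images of the atoms on the unit circle. -/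
theorem exists_monic_vanishing (s : Finset ℝ) (m : ℕ) (hs : s.card ≤ m) (ω : ℝ) :
    ∃ p : ℂ[X], p.Monic ∧ p.natDegree = m ∧
      (∀ θ ∈ s, p.eval (Complex.exp (ω * θ * Complex.I)) = 0) ∧
      ∑ j ∈ Finset.range (m + 1), ‖p.coeff j‖ ≤ 2 ^ m := by
  -- If there are fewer than `m` atoms, the missing roots are put at `0`.
  let p : ℂ[X] := (∏ θ ∈ s, (X - C (Complex.exp (ω * θ * Complex.I)))) * X ^ (m - s.card)
  have hprod : (∏ θ ∈ s, (X - C (Complex.exp (ω * θ * Complex.I)))).Monic :=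
    monic_prod_X_sub_C _ _
  have hmon : p.Monic := hprod.mul (monic_X_pow _)
  have hdeg : p.natDegree = m := by
    rw [hprod.natDegree_mul (monic_X_pow _), natDegree_prod_of_monic _ _ fun θ _ => monic_X_sub_C _]
    simp [hs]
  refine ⟨p, hmon, hdeg, fun θ hθ => ?_, ?_⟩
  · rw [eval_mul, eval_prod, Finset.prod_eq_zero hθ (by simp), zero_mul]
  · have hroots : ∀ z ∈ (p.map (RingHom.id ℂ)).roots, ‖z‖ ≤ 1 := by
      intro z hz
      rw [Polynomial.map_id] at hz
      have h0 := (mem_roots'.1 hz).2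
      rw [IsRoot.def, eval_mul, eval_prod, mul_eq_zero, Finset.prod_eq_zero_iff] at h0
      rcases h0 with ⟨θ, -, h⟩ | h
      · rw [eval_sub, eval_X, eval_C, sub_eq_zero] at h
        rw [h, ← Complex.ofReal_mul, Complex.norm_exp_ofReal_mul_I]
      · rw [eval_pow, eval_X] at h
        simp [eq_zero_of_pow_eq_zero h]
    calc ∑ j ∈ Finset.range (m + 1), ‖p.coeff j‖
        ≤ ∑ j ∈ Finset.range (m + 1), (m.choose j : ℝ) := by
          refine Finset.sum_le_sum fun j _ => ?_
          have := coeff_le_of_roots_le j hmon (IsAlgClosed.splits _) hroots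
          simpa [hdeg] using this
      _ = 2 ^ m := by exact_mod_cast Nat.sum_range_choose m

open Polynomial in
theorem integral_normSq_eval_eq_zero (Q : Measure ℝ) (s : Finset ℝ) (hs : Q ((s : Set ℝ)ᶜ) = 0)
    (p : ℂ[X]) (ω : ℝ) (hp : ∀ θ ∈ s, p.eval (Complex.exp (ω * θ * Complex.I)) = 0) :
    ∫ θ : ℝ, ‖p.eval (Complex.exp (ω * θ * Complex.I))‖ ^ 2 ∂Q = 0 := by
  refine integral_eq_zero_of_ae ?_
  have h : ∀ᵐ θ ∂Q, θ ∈ (s : Set ℝ) := hs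
  filter_upwards [h] with θ hθ
  simp [hp θ hθ]

/-! ### The uniform distribution -/

theorem isProbabilityMeasure_uniformDistribution {M : ℝ} (hM : 0 < M) :
    IsProbabilityMeasure (uniformDistribution M) := by
  refine cond_isProbabilityMeasure_of_finite ?_ (by simp)
  simp [Real.volume_Icc, hM]

theorem charFun_uniformDistribution {M : ℝ} (hM : 0 < M) (n : ℤ) (hn : n ≠ 0) :
    charFun (uniformDistribution M) (n * (Real.pi / M)) = 0 := by
  rw [charFun_apply_real, uniformDistribution, ProbabilityTheory.cond, integral_smul_measure]
  suffices h : ∫ x in Set.Icc (-M) M,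
      Complex.exp ((n * (Real.pi / M) : ℝ) * x * Complex.I) = 0 by rw [h, smul_zero]
  have hc : ((n * (Real.pi / M) : ℝ) : ℂ) * Complex.I ≠ 0 := by
    refine mul_ne_zero ?_ Complex.I_ne_zero
    exact_mod_cast mul_ne_zero (by exact_mod_cast hn) (by positivity)
  rw [integral_Icc_eq_integral_Ioc, ← intervalIntegral.integral_of_le (by linarith)]
  simp_rw [mul_right_comm _ _ Complex.I]
  rw [integral_exp_mul_complex hc]
  -- The endpoints differ by a period of the exponential.
  have hM' : (M : ℂ) ≠ 0 := by exact_mod_cast hM.ne'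
  have hper : ((n * (Real.pi / M) : ℝ) : ℂ) * Complex.I * (M : ℝ) =
      ((n * (Real.pi / M) : ℝ) : ℂ) * Complex.I * ((-M : ℝ) : ℂ) +
        n * (2 * Real.pi * Complex.I) := by
    push_cast
    field_simp
    ring
  rw [hper, Complex.exp_periodic.int_mul n, sub_self, zero_div]

open Polynomial in
theorem integral_normSq_eval_uniformDistribution {M : ℝ} (hM : 0 < M) (p : ℂ[X]) (m : ℕ)
    (hp : p.natDegree ≤ m) :
    ∫ θ : ℝ, ‖p.eval (Complex.exp ((Real.pi / M : ℝ) * θ * Complex.I))‖ ^ 2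
        ∂(uniformDistribution M) = ∑ j ∈ Finset.range (m + 1), ‖p.coeff j‖ ^ 2 := by
  have := isProbabilityMeasure_uniformDistribution hM
  apply Complex.ofReal_injective
  rw [integral_normSq_eval_exp _ p m hp, Complex.ofReal_sum]
  refine Finset.sum_congr rfl fun j hj => ?_
  rw [Finset.sum_eq_single_of_mem j hj fun k _ hkj => ?_]
  · simp [Complex.mul_conj']
  · have h := charFun_uniformDistribution hM ((j : ℤ) - k) (by omega)
    push_cast at h
    rw [h, mul_zero]

theorem le_bestError_uniformDistribution (M : ℝ) (m : ℕ) (hM : 0 < M) (hm : 1 ≤ m) :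
    ENNReal.ofReal
        (1 / (4 * (m : ℝ)) * Real.exp (-(Real.pi ^ 2 * (m : ℝ) ^ 2 / (2 * M ^ 2)))) ≤
      bestError m (uniformDistribution M) tvDist := by
  have := isProbabilityMeasure_uniformDistribution hM
  refine le_iInf₂ fun Q hQ => ?_
  obtain ⟨hQprob, s, hcard, hs⟩ := hQ
  refine le_trans (ENNReal.ofReal_le_ofReal ?_) (ofReal_integral_abs_sub_le_tvDist _ Q)
  obtain ⟨p, hmon, hdeg, hvan, -⟩ := exists_monic_vanishing s m hcard (Real.pi / M)
  have key := abs_integral_normSq_eval_sub_le (uniformDistribution M) Q p m hdeg.le (Real.pi / M)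
  rw [integral_normSq_eval_eq_zero Q s hs p _ hvan,
    integral_normSq_eval_uniformDistribution hM p m hdeg.le, zero_sub, abs_neg] at key
  set T := ∫ x, |mixtureDensity Q x - mixtureDensity (uniformDistribution M) x|
  have hT0 : 0 ≤ T := integral_nonneg fun x => abs_nonneg _
  set S := ∑ j ∈ Finset.range (m + 1), ‖p.coeff j‖ ^ 2
  have hS : 0 < S := by
    refine Finset.sum_pos' (fun j _ => by positivity) ⟨m, by simp, ?_⟩
    have : p.coeff m = 1 := by rw [← hdeg]; exact hmon
    simp [this]
  have hcs : (∑ j ∈ Finset.range (m + 1), ‖p.coeff j‖) ^ 2 ≤ (m + 1) * S := by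
    simpa using sq_sum_le_card_mul_sum_sq (s := Finset.range (m + 1)) (f := fun j => ‖p.coeff j‖)
  rw [abs_of_pos hS] at key
  have hexp : (m * (Real.pi / M)) ^ 2 / 2 = Real.pi ^ 2 * (m : ℝ) ^ 2 / (2 * M ^ 2) := by
    field_simp
  rw [hexp] at key
  set e := Real.pi ^ 2 * (m : ℝ) ^ 2 / (2 * M ^ 2)
  have h1 : 1 ≤ m * (Real.exp e * T) := by
    have h2 : S * 1 ≤ S * (m * (Real.exp e * T)) := by
      have : 0 ≤ Real.exp e * T := by positivity
      nlinarith
    exact le_of_mul_le_mul_left h2 hS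
  have hm' : (0 : ℝ) < m := by exact_mod_cast hm
  rw [Real.exp_neg, ← div_eq_mul_inv, div_le_iff₀ (Real.exp_pos _), div_le_iff₀ (by positivity)]
  nlinarith

/-! ### Equally spaced points -/

/-- The uniform distribution on the `m + 1` equally spaced points `-M + 2 M l / m`, `0 ≤ l ≤ m`,
of `[-M, M]`. -/
noncomputable def equispacedDistribution (M : ℝ) (m : ℕ) : Measure ℝ :=
  ((m + 1 : ℕ) : ℝ≥0∞)⁻¹ • ∑ l ∈ Finset.range (m + 1), Measure.dirac (-M + 2 * M * l / m)

theorem equispacedDistribution_mem {M : ℝ} {m : ℕ} (hM : 0 < M) (hm : 1 ≤ m) :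
    equispacedDistribution M m ∈ boundedDistributions M := by
  have hinv : ((m + 1 : ℕ) : ℝ≥0∞)⁻¹ * (m + 1 : ℕ) = 1 :=
    ENNReal.inv_mul_cancel (by simp) (ENNReal.natCast_ne_top _)
  have hm' : (0 : ℝ) < m := by exact_mod_cast hm
  refine ⟨⟨?_⟩, ?_⟩
  · simpa [equispacedDistribution] using hinv
  · rw [equispacedDistribution, Measure.smul_apply, Measure.finsetSum_apply,
      Finset.sum_congr rfl (g := fun _ => 1) fun l hl => ?_]
    · simpa using hinv
    · have hl' : (l : ℝ) ≤ m := by exact_mod_cast Nat.lt_succ_iff.1 (Finset.mem_range.1 hl)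
      rw [Measure.dirac_apply' _ measurableSet_Icc, Set.indicator_of_mem, Pi.one_apply]
      have h1 : 2 * M * l / m ≤ 2 * M := by
        rw [div_le_iff₀ hm']; gcongr
      have h2 : 0 ≤ 2 * M * l / m := by positivity
      exact ⟨by linarith, by linarith⟩

theorem integral_equispacedDistribution (M : ℝ) (m : ℕ) (f : ℝ → ℝ) :
    ∫ θ, f θ ∂(equispacedDistribution M m) =
      ((m : ℝ) + 1)⁻¹ * ∑ l ∈ Finset.range (m + 1), f (-M + 2 * M * l / m) := by
  rw [equispacedDistribution, integral_smul_measure, integral_finsetSum_measure]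
  · simp only [integral_dirac, ENNReal.toReal_inv, ENNReal.toReal_natCast, smul_eq_mul]
    rw [Nat.cast_succ]
  · exact fun l _ => integrable_dirac (by simp)

/-- A chord of the unit circle is at least `2 / π` times its arc. -/
theorem two_div_pi_mul_abs_le_norm_exp_sub_exp (a b : ℝ) (h : |a - b| ≤ Real.pi) :
    2 / Real.pi * |a - b| ≤ ‖Complex.exp (a * Complex.I) - Complex.exp (b * Complex.I)‖ := by
  have h1 : Complex.exp (a * Complex.I) - Complex.exp (b * Complex.I) =
      Complex.exp (b * Complex.I) * (Complex.exp (Complex.I * (a - b : ℝ)) - 1) := by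
    rw [mul_sub, ← Complex.exp_add, mul_one]
    congr 2
    push_cast
    ring
  rw [h1, norm_mul, Complex.norm_exp_ofReal_mul_I, one_mul,
    Complex.norm_exp_I_mul_ofReal_sub_one, norm_mul, Real.norm_two, Real.norm_eq_abs]
  have h2 : |Real.sin ((a - b) / 2)| = Real.sin (|a - b| / 2) := by
    rcases abs_cases (a - b) with ⟨h', h0⟩ | ⟨h', h0⟩
    · rw [h', abs_of_nonneg (Real.sin_nonneg_of_nonneg_of_le_pi (by linarith) (by linarith))]
    · rw [h', neg_div, Real.sin_neg, abs_of_nonpos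
        (Real.sin_nonpos_of_nonpos_of_neg_pi_le (by linarith) (by linarith))]
  rw [h2]
  have := Real.mul_le_sin (x := |a - b| / 2) (by positivity) (by linarith)
  linarith

theorem prod_erase_abs_sub (m l : ℕ) (hl : l ≤ m) :
    ∏ k ∈ (Finset.range (m + 1)).erase l, |(l : ℝ) - k| = l.factorial * (m - l).factorial := by
  have hset : (Finset.range (m + 1)).erase l = Finset.range l ∪ Finset.Ico (l + 1) (m + 1) := by
    ext k
    simp only [Finset.mem_erase, Finset.mem_range, Finset.mem_union, Finset.mem_Ico]
    omega
  have hdisj : Disjoint (Finset.range l) (Finset.Ico (l + 1) (m + 1)) := by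
    rw [Finset.disjoint_left]
    intro k hk hk'
    simp only [Finset.mem_range, Finset.mem_Ico] at hk hk'
    omega
  -- The factors below `l` give `l!`, those above it `(m - l)!`.
  rw [hset, Finset.prod_union hdisj]
  congr 1
  · rw [← Finset.prod_range_reflect, ← Finset.prod_range_add_one_eq_factorial, Nat.cast_prod]
    refine Finset.prod_congr rfl fun k hk => ?_
    have hk := Finset.mem_range.1 hk
    rw [Nat.sub_sub, Nat.cast_sub (by omega), sub_sub_cancel, abs_of_nonneg (by positivity)]
    push_cast
    ring
  · rw [Finset.prod_Ico_eq_prod_range, ← Finset.prod_range_add_one_eq_factorial, Nat.cast_prod,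
      show m + 1 - (l + 1) = m - l by omega]
    refine Finset.prod_congr rfl fun k hk => ?_
    rw [show (l : ℝ) - ((l + 1 + k : ℕ) : ℝ) = -((k : ℝ) + 1) by push_cast; ring, abs_neg,
      abs_of_nonneg (by positivity)]
    push_cast
    ring

/-- The product is at least `m! / 2 ^ m`, since `m.choose l ≤ 2 ^ m`, and `m! ≥ (m / e) ^ m`. -/
theorem div_pow_le_prod_erase_abs_sub (m l : ℕ) (hl : l ≤ m) :
    ((m : ℝ) / (2 * Real.exp 1)) ^ m ≤ ∏ k ∈ (Finset.range (m + 1)).erase l, |(l : ℝ) - k| := by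
  rw [prod_erase_abs_sub m l hl, div_pow, mul_pow, div_le_iff₀ (by positivity)]
  have h1 := Real.pow_div_factorial_le_exp (x := m) (by positivity) m
  rw [div_le_iff₀ (by positivity), ← mul_one (m : ℝ), Real.exp_nat_mul, mul_one] at h1
  have h2 : (m.factorial : ℝ) ≤ 2 ^ m * (l.factorial * (m - l).factorial) := by
    rw [← Nat.choose_mul_factorial_mul_factorial hl, mul_assoc]
    push_cast
    gcongr
    exact_mod_cast Nat.choose_le_two_pow m l
  calc (m : ℝ) ^ m ≤ Real.exp 1 ^ m * m.factorial := h1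
    _ ≤ Real.exp 1 ^ m * (2 ^ m * (l.factorial * (m - l).factorial)) := by gcongr
    _ = _ := by ring

open Polynomial in
/-- A monic polynomial of degree `m` cannot be small at `m + 1` well separated points: by Lagrange
interpolation its leading coefficient is a combination of its values there. -/
theorem Polynomial.Monic.le_sum_norm_eval {p : ℂ[X]} (hp : p.Monic) {m : ℕ}
    (hdeg : p.natDegree = m) (z : ℕ → ℂ) {D : ℝ} (hD : 0 < D)
    (hz : ∀ l ∈ Finset.range (m + 1), D ≤ ∏ k ∈ (Finset.range (m + 1)).erase l, ‖z l - z k‖) :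
    D ≤ ∑ l ∈ Finset.range (m + 1), ‖p.eval (z l)‖ := by
  have hinj : Set.InjOn z (Finset.range (m + 1) : Set ℕ) := by
    intro j hj k hk hjk
    by_contra hne
    have h0 := hz j hj
    rw [Finset.prod_eq_zero (Finset.mem_erase.2 ⟨Ne.symm hne, hk⟩) (by simp [hjk])] at h0
    linarith
  have h1 := Lagrange.leadingCoeff_eq_sum (P := p) hinj
    (by rw [Finset.card_range, degree_eq_natDegree hp.ne_zero, hdeg]; norm_cast)
  rw [hp.leadingCoeff] at h1
  have h2 : 1 ≤ (∑ l ∈ Finset.range (m + 1), ‖p.eval (z l)‖) / D := by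
    calc (1 : ℝ) = ‖(1 : ℂ)‖ := norm_one.symm
      _ ≤ ∑ l ∈ Finset.range (m + 1), ‖p.eval (z l)‖ / D := by
        rw [h1]
        refine norm_sum_le_of_le _ fun l hl => ?_
        rw [norm_div, norm_prod]
        exact div_le_div_of_nonneg_left (norm_nonneg _) hD (hz l hl)
      _ = _ := by rw [Finset.sum_div]
  rwa [le_div_iff₀ hD, one_mul] at h2

theorem pow_le_prod_norm_exp_sub (M ω : ℝ) (m : ℕ) (hM : 0 < M) (hω : 0 < ω) (hm : 1 ≤ m)
    (h : 2 * M * ω ≤ Real.pi) (l : ℕ) (hl : l ∈ Finset.range (m + 1)) :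
    (ω * M / 5) ^ m ≤ ∏ k ∈ (Finset.range (m + 1)).erase l,
      ‖Complex.exp (ω * (-M + 2 * M * l / m : ℝ) * Complex.I) -
        Complex.exp (ω * (-M + 2 * M * k / m : ℝ) * Complex.I)‖ := by
  have hm' : (0 : ℝ) < m := by exact_mod_cast hm
  have hl' := Nat.lt_succ_iff.1 (Finset.mem_range.1 hl)
  set c := 4 * M * ω / (Real.pi * m) with hc
  have hc0 : 0 ≤ c := by positivity
  calc (ω * M / 5) ^ m ≤ (c * (m / (2 * Real.exp 1))) ^ m := by
        gcongr
        rw [hc, show 4 * M * ω / (Real.pi * m) * (m / (2 * Real.exp 1)) =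
          ω * M * (2 / (Real.pi * Real.exp 1)) by field_simp; ring, div_eq_mul_inv]
        gcongr
        rw [le_div_iff₀ (by positivity)]
        have := Real.exp_one_lt_d9
        have := Real.pi_lt_d2
        nlinarith [Real.pi_pos, Real.exp_pos 1]
    _ = c ^ m * (m / (2 * Real.exp 1)) ^ m := mul_pow _ _ _
    _ ≤ c ^ m * ∏ k ∈ (Finset.range (m + 1)).erase l, |(l : ℝ) - k| := by
        gcongr
        exact div_pow_le_prod_erase_abs_sub m l hl'
    _ = ∏ k ∈ (Finset.range (m + 1)).erase l, c * |(l : ℝ) - k| := by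
        rw [Finset.prod_mul_distrib, Finset.prod_const, Finset.card_erase_of_mem hl,
          Finset.card_range, Nat.add_sub_cancel]
    _ ≤ _ := by
        refine Finset.prod_le_prod (fun k _ => by positivity) fun k hk => ?_
        have hk' := Nat.lt_succ_iff.1 (Finset.mem_range.1 (Finset.mem_of_mem_erase hk))
        have hdiff : ω * (-M + 2 * M * l / m) - ω * (-M + 2 * M * k / m) =
            2 * M * ω / m * (l - k) := by ring
        have habs : |ω * (-M + 2 * M * l / m) - ω * (-M + 2 * M * k / m)| =
            2 * M * ω / m * |(l : ℝ) - k| := by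
          rw [hdiff, abs_mul, abs_of_nonneg (by positivity)]
        have hlk : |(l : ℝ) - k| ≤ m := by
          have h1 : (l : ℝ) ≤ m := by exact_mod_cast hl'
          have h2 : (k : ℝ) ≤ m := by exact_mod_cast hk'
          rw [abs_le]
          constructor <;> linarith [l.cast_nonneg (α := ℝ), k.cast_nonneg (α := ℝ)]
        have := two_div_pi_mul_abs_le_norm_exp_sub_exp (ω * (-M + 2 * M * l / m))
          (ω * (-M + 2 * M * k / m)) (by
            rw [habs]
            calc 2 * M * ω / m * |(l : ℝ) - k| ≤ 2 * M * ω / m * m := by gcongr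
              _ = 2 * M * ω := by field_simp
              _ ≤ Real.pi := h)
        rw [habs] at this
        refine le_trans (le_of_eq ?_) (this.trans_eq ?_)
        · rw [hc]; ring
        · push_cast; rfl

/-- The exponent `9` absorbs the exponential constants, as `2400 ≤ 4 ^ 8 ≤ r ^ 8`. -/
theorem exp_neg_nine_mul_log_le {r : ℝ} (hr : 4 ≤ r) (m : ℕ) :
    Real.exp (-(9 * m * Real.log r)) ≤ (1 / (2400 * r)) ^ m := by
  have hr0 : 0 < r := by linarith
  rw [show -(9 * m * Real.log r) = m * (-(9 * Real.log r)) by ring, Real.exp_nat_mul]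
  gcongr
  rw [Real.exp_neg, show (9 : ℝ) * Real.log r = (9 : ℕ) * Real.log r by norm_num,
    Real.exp_nat_mul, Real.exp_log hr0, ← one_div]
  gcongr
  have h8 : (4 : ℝ) ^ 8 ≤ r ^ 8 := by gcongr
  calc 2400 * r ≤ r ^ 8 * r := by
        gcongr
        exact le_trans (by norm_num) h8
    _ = r ^ 9 := by ring

theorem le_bestError_equispacedDistribution (M : ℝ) (m : ℕ) (hM : 0 < M) (hm : 1 ≤ m)
    (h : 4 * M ^ 2 ≤ m) :
    ENNReal.ofReal (Real.exp (-(9 * (m : ℝ) * Real.log ((m : ℝ) / M ^ 2)))) ≤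
      bestError m (equispacedDistribution M m) tvDist := by
  have := (equispacedDistribution_mem hM hm).1
  have hm' : (0 : ℝ) < m := by exact_mod_cast hm
  refine le_iInf₂ fun Q hQ => ?_
  obtain ⟨hQprob, s, hcard, hs⟩ := hQ
  refine le_trans (ENNReal.ofReal_le_ofReal ?_) (ofReal_integral_abs_sub_le_tvDist _ Q)
  -- This frequency makes the Gaussian factor `exp ((m * ω) ^ 2 / 2)` only exponential in `m`.
  set ω : ℝ := (Real.sqrt m)⁻¹ with hω
  have hsq : Real.sqrt m ^ 2 = m := Real.sq_sqrt hm'.le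
  have hω0 : 0 < ω := by positivity
  have hω2 : ω ^ 2 = (m : ℝ)⁻¹ := by rw [hω, inv_pow, hsq]
  have hMω : 2 * M * ω ≤ Real.pi := by
    have : 2 * M * ω ≤ 1 := by
      rw [hω, ← div_eq_mul_inv, div_le_one (by positivity)]
      exact Real.le_sqrt_of_sq_le (by linarith)
    linarith [Real.pi_gt_three]
  obtain ⟨p, hmon, hdeg, hvan, hcoeff⟩ := exists_monic_vanishing s m hcard ω
  have key := abs_integral_normSq_eval_sub_le (equispacedDistribution M m) Q p m hdeg.le ω
  set T := ∫ x, |mixtureDensity Q x - mixtureDensity (equispacedDistribution M m) x|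
  have hT0 : 0 ≤ T := integral_nonneg fun x => abs_nonneg _
  have hlow := hmon.le_sum_norm_eval hdeg
    (fun l => Complex.exp (ω * (-M + 2 * M * l / m : ℝ) * Complex.I)) (by positivity)
    (pow_le_prod_norm_exp_sub M ω m hM hω0 hm hMω)
  rw [integral_normSq_eval_eq_zero Q s hs p _ hvan, integral_equispacedDistribution, zero_sub,
    abs_neg] at key
  set F : ℕ → ℝ := fun l =>
    ‖p.eval (Complex.exp (ω * (-M + 2 * M * l / m : ℝ) * Complex.I))‖
  have hcs : (∑ l ∈ Finset.range (m + 1), F l) ^ 2 ≤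
      (m + 1) * ∑ l ∈ Finset.range (m + 1), F l ^ 2 := by
    simpa using sq_sum_le_card_mul_sum_sq (s := Finset.range (m + 1)) (f := F)
  have hup : ((m : ℝ) + 1)⁻¹ * ∑ l ∈ Finset.range (m + 1), F l ^ 2 ≤ 4 ^ m * (3 ^ m * T) := by
    refine (le_abs_self _).trans (key.trans ?_)
    have h4 : (∑ j ∈ Finset.range (m + 1), ‖p.coeff j‖) ^ 2 -
        ∑ j ∈ Finset.range (m + 1), ‖p.coeff j‖ ^ 2 ≤ 4 ^ m := by
      have h0 : 0 ≤ ∑ j ∈ Finset.range (m + 1), ‖p.coeff j‖ ^ 2 := by positivity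
      have h1 : (∑ j ∈ Finset.range (m + 1), ‖p.coeff j‖) ^ 2 ≤ (2 ^ m) ^ 2 := by gcongr
      rw [← pow_mul, mul_comm, pow_mul] at h1
      norm_num at h1
      linarith
    have hexp : Real.exp ((m * ω) ^ 2 / 2) ≤ 3 ^ m := by
      rw [mul_pow, hω2, show (m : ℝ) ^ 2 * (m : ℝ)⁻¹ / 2 = m * (1 / 2) by field_simp,
        Real.exp_nat_mul]
      gcongr
      exact (Real.exp_le_exp.2 (by norm_num)).trans Real.exp_one_lt_three.le
    gcongr
  have hm2 : ((m : ℝ) + 1) ≤ 2 ^ m := by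
    exact_mod_cast Nat.lt_two_pow_self
  have hD : ((M ^ 2 / m) / 25) ^ m ≤ 4 ^ m * (4 ^ m * (3 ^ m * T)) := by
    calc ((M ^ 2 / m) / 25) ^ m = ((ω * M / 5) ^ m) ^ 2 := by
          rw [← pow_mul, mul_comm m 2, pow_mul, div_pow (ω * M), mul_pow, hω2]
          congr 1
          ring
      _ ≤ (∑ l ∈ Finset.range (m + 1), F l) ^ 2 := by gcongr
      _ ≤ (m + 1) * ∑ l ∈ Finset.range (m + 1), F l ^ 2 := hcs
      _ = (m + 1) ^ 2 * (((m : ℝ) + 1)⁻¹ * ∑ l ∈ Finset.range (m + 1), F l ^ 2) := by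
          field_simp
      _ ≤ (2 ^ m) ^ 2 * (4 ^ m * (3 ^ m * T)) := by gcongr
      _ = 4 ^ m * (4 ^ m * (3 ^ m * T)) := by rw [← pow_mul, mul_comm m 2, pow_mul]; norm_num
  have hr : 4 ≤ (m : ℝ) / M ^ 2 := by rwa [le_div_iff₀ (by positivity)]
  refine (exp_neg_nine_mul_log_le hr m).trans ?_
  -- `25 * 4 * 4 * 3 * 2 = 2400`, where the last factor absorbs the `2` of `T / 2`.
  have h2 : (2 : ℝ) ≤ 2 ^ m := by simpa using pow_le_pow_right₀ one_le_two hm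
  calc (1 / (2400 * ((m : ℝ) / M ^ 2))) ^ m
      = ((M ^ 2 / m) / 25) ^ m / (4 ^ m * 4 ^ m * 3 ^ m * 2 ^ m) := by
        rw [← mul_pow, ← mul_pow, ← mul_pow, ← div_pow]
        congr 1
        field_simp
        norm_num
    _ ≤ 4 ^ m * (4 ^ m * (3 ^ m * T)) / (4 ^ m * 4 ^ m * 3 ^ m * 2 ^ m) := by gcongr
    _ = T / 2 ^ m := by field_simp
    _ ≤ T / 2 := by gcongr

theorem theorem6 :
    (∀ (M : ℝ) (m : ℕ), 0 < M → 1 ≤ m →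
      ENNReal.ofReal
          (1 / (4 * (m : ℝ)) * Real.exp (-(Real.pi ^ 2 * (m : ℝ) ^ 2 / (2 * M ^ 2)))) ≤
        bestError m (uniformDistribution M) tvDist) ∧
    (∃ C₁ C' : ℝ, 0 < C₁ ∧ 0 < C' ∧
      ∀ (M : ℝ) (m : ℕ), 0 < M → 1 ≤ m → C' * M ^ 2 ≤ (m : ℝ) →
        ENNReal.ofReal (Real.exp (-(C₁ * (m : ℝ) * Real.log ((m : ℝ) / M ^ 2)))) ≤
          worstError m (boundedDistributions M) tvDist) :=
  ⟨le_bestError_uniformDistribution, 9, 4, by norm_num, by norm_num, fun M m hM hm h =>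
    (le_bestError_equispacedDistribution M m hM hm h).trans
      (le_iSup₂_of_le _ (equispacedDistribution_mem hM hm) le_rfl)⟩
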